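/- Let $f:\mathbb{R}^n\to[0,\infty]$ be continuous and differentiable on $\mathrm{dom} f=\{f<\infty\}$, let $g:\mathbb{R}^m\times\mathbb{R}^l\to[0,\infty]$ be continuous and $C^2$ on $\mathrm{dom}\, g$ (continuity is with respect to the topology of $[0,\infty]$), let $A\in\mathbb{R}^{m\times n}$, $\sigma>0$, and let $\mathcal{Z}\subseteq\mathbb{R}^l$ be convex. Assume that $f(x)+g(Ax,z)\to\infty$ as $\|(x,z)\|\to\infty$, that $g(\cdot,z)$ is convex for every $z$, that $g(y,\cdot)$ is $\sigma$-strongly convex for every $y$, and that $x^0\in\mathbb{R}^n$ is strictly feasible, i.e. $f(x^0)+g(Ax^0,z)<\infty$ for some $z\in\mathcal{Z}$. Put $$\mathcal{L}(x,y,z,\lambda)=f(x)+g(y,z)+\tfrac{\beta}{2}\|Ax-y\|^2+\lambda^T(Ax-y).$$ BC-ADMM with parameters $\beta_x,\beta_y,\beta$ starts from $x^0$, $y^0=Ax^0$, $z^0=\arg\min_{z\in\mathcal{Z}}g(y^0,z)$, $\lambda^0=\nabla_yg(y^0,z^0)$ and iterates - $x^{k+1}$: a local minimizer of $x\mapsto\mathcal{L}(x,y^k,z^k,\lambda^k)+\frac{\beta_x}{2}\|x-x^k\|^2$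 whose objective value is at most that of $x^k$ (for instance a global minimizer); - $y^{k+1}=\arg\min_y\mathcal{L}(x^{k+1},y,z^k,\lambda^k)+\frac{\beta_y}{2}\|y-y^k\|^2$; - $z^{k+1}=\arg\min_{z\in\mathcal{Z}}\mathcal{L}(x^{k+1},y^{k+1},z,\lambda^k)$; - $\lambda^{k+1}=\lambda^k+\beta(Ax^{k+1}-y^{k+1})$. Call $(x,z)$ an $\epsilon$-stationary point of $\min_{x,\,z\in\mathcal{Z}}f(x)+g(Ax,z)$ if $z\in\mathcal{Z}$, $f(x)+g(Ax,z)<\infty$, $\|\nabla f(x)+A^T\nabla_yg(Ax,z)\|\le\epsilon$ and $\mathrm{dist}(-\nabla_zg(Ax,z),N_{\mathcal{Z}}(z))\le\epsilon$, where $N_{\mathcal{Z}}(z)=\{v: v^T(w-z)\le 0\ \forall w\in\mathcal{Z}\}$ is the normal cone. Then there is a constant $C>0$, depending only on $f,g,A,\mathcal{Z},\sigma,x^0$, such that for all $\beta_x\ge C$, $\beta_y\ge C$ and $\beta\ge C\beta_y$: 1. if $\mathcal{Z}$ is closed, an infinite sequence of BC-ADMM iterates exists; 2. every BC-ADMM iterate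 is strictly feasible: $f(x^k)+g(Ax^k,z^k)<\infty$ for all $k$; 3. BC-ADMM reaches an $\epsilon$-stationary point with oracle complexity $O(\epsilon^{-2})$: there is a constant $D$, independent of $\epsilon$ and of the particular sequence of iterates, such that for every $\epsilon>0$ every sequence of BC-ADMM iterates contains an $\epsilon$-stationary point $(x^k,z^k)$ with $k\le D\epsilon^{-2}$. -/

import Mathlib

open scoped ENNReal Gradient InnerProductSpace Topology
open Filter Set

namespace BCADMM

noncomputable section

/-- The Euclidean space `ℝⁿ`. -/
abbrev Vec (n : ℕ) := EuclideanSpace ℝ (Fin n)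

/-- The effective domain of an extended-real function. -/
def dom {X : Type*} (h : X → ℝ≥0∞) : Set X := {p | h p ≠ ⊤}

/-- The gradient at `u` of a function with values in `[0, ∞]`, meaningful where the
function is finite near `u` and differentiable at `u`. -/
def grad {n : ℕ} (h : Vec n → ℝ≥0∞) (u : Vec n) : Vec n :=
  ∇ (fun v => (h v).toReal) u

/-- The partial gradient of `g` in its first block of variables. -/
def gradY {m l : ℕ} (g : Vec m × Vec l → ℝ≥0∞) (y : Vec m) (z : Vec l) : Vec m :=
  grad (fun y' => g (y', z)) y

/-- The partial gradient of `g` in its second block of variables. -/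
def gradZ {m l : ℕ} (g : Vec m × Vec l → ℝ≥0∞) (y : Vec m) (z : Vec l) : Vec l :=
  grad (fun z' => g (y, z')) z

/-- The normal cone at a point `z` of a convex set `Z`. -/
def normalCone {l : ℕ} (Z : Set (Vec l)) (z : Vec l) : Set (Vec l) :=
  {v | ∀ w ∈ Z, ⟪v, w - z⟫_ℝ ≤ 0}

/-- `h` tends to `∞` at infinity. -/
def Coercive {X : Type*} [TopologicalSpace X] (h : X → ℝ≥0∞) : Prop :=
  Tendsto h (cocompact X) (𝓝 ⊤)

/-- The augmented Lagrangian
`f(x) + g(y, z) + (β/2) ‖A x - y‖² + λᵀ (A x - y)`, with values in `(-∞, ∞]`. -/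
def lagrangian {n m l : ℕ} (f : Vec n → ℝ≥0∞) (g : Vec m × Vec l → ℝ≥0∞)
    (A : Vec n →L[ℝ] Vec m) (β : ℝ) (x : Vec n) (y : Vec m) (z : Vec l) (lam : Vec m) : EReal :=
  (f x : EReal) + (g (y, z) : EReal)
    + ((β / 2 * ‖A x - y‖ ^ 2 + ⟪lam, A x - y⟫_ℝ : ℝ) : EReal)

/-- The objective of the `x`-subproblem, with proximal center `xc`. -/
def xObj {n m l : ℕ} (f : Vec n → ℝ≥0∞) (g : Vec m × Vec l → ℝ≥0∞)
    (A : Vec n →L[ℝ] Vec m) (βx β : ℝ) (xc : Vec n) (y : Vec m) (z : Vec l) (lam : Vec m)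
    (x : Vec n) : EReal :=
  lagrangian f g A β x y z lam + ((βx / 2 * ‖x - xc‖ ^ 2 : ℝ) : EReal)

/-- The objective of the `y`-subproblem, with proximal center `yc`. -/
def yObj {n m l : ℕ} (f : Vec n → ℝ≥0∞) (g : Vec m × Vec l → ℝ≥0∞)
    (A : Vec n →L[ℝ] Vec m) (βy β : ℝ) (x : Vec n) (yc : Vec m) (z : Vec l) (lam : Vec m)
    (y : Vec m) : EReal :=
  lagrangian f g A β x y z lam + ((βy / 2 * ‖y - yc‖ ^ 2 : ℝ) : EReal)

/-- `(x, y, z, lam)` is a sequence of iterates that BC-ADMM can generate from the starting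
point `x₀` with parameters `βx`, `βy`, `β`. The nonconvex `x`-subproblem is solved locally
starting from the guess `x k`: the solver returns a local minimizer whose objective value is not
larger than that of `x k` (a global minimizer is a particular case). The `y`- and
`z`-subproblems are solved globally. -/
structure IsRun {n m l : ℕ} (f : Vec n → ℝ≥0∞) (g : Vec m × Vec l → ℝ≥0∞)
    (A : Vec n →L[ℝ] Vec m) (Z : Set (Vec l)) (βx βy β : ℝ) (x₀ : Vec n)
    (x : ℕ → Vec n) (y : ℕ → Vec m) (z : ℕ → Vec l) (lam : ℕ → Vec m) : Prop where
  x_zero : x 0 = x₀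
  y_zero : y 0 = A x₀
  z_zero_mem : z 0 ∈ Z
  z_zero_min : IsMinOn (fun w => g (y 0, w)) Z (z 0)
  lam_zero : lam 0 = gradY g (y 0) (z 0)
  x_locMin : ∀ k, IsLocalMin (xObj f g A βx β (x k) (y k) (z k) (lam k)) (x (k + 1))
  x_descent : ∀ k, xObj f g A βx β (x k) (y k) (z k) (lam k) (x (k + 1))
    ≤ xObj f g A βx β (x k) (y k) (z k) (lam k) (x k)
  y_min : ∀ k, IsMinOn (yObj f g A βy β (x (k + 1)) (y k) (z k) (lam k)) univ (y (k + 1))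
  z_mem : ∀ k, z (k + 1) ∈ Z
  z_min : ∀ k, IsMinOn (fun w => lagrangian f g A β (x (k + 1)) (y (k + 1)) w (lam k)) Z
    (z (k + 1))
  lam_succ : ∀ k, lam (k + 1) = lam k + β • (A (x (k + 1)) - y (k + 1))

/-- `(x, z)` is an `ε`-stationary point of `min f(x) + g(A x, z)` over `x` and `z ∈ Z`: it is
feasible with finite objective, `‖∇f(x) + Aᵀ ∇_y g(A x, z)‖ ≤ ε`, and `-∇_z g(A x, z)` is within
distance `ε` of the normal cone of `Z` at `z`. -/
structure IsStationary {n m l : ℕ} (f : Vec n → ℝ≥0∞) (g : Vec m × Vec l → ℝ≥0∞)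
    (A : Vec n →L[ℝ] Vec m) (Z : Set (Vec l)) (ε : ℝ) (x : Vec n) (z : Vec l) : Prop where
  mem : z ∈ Z
  finite : f x + g (A x, z) < ⊤
  grad_x : ‖grad f x + (ContinuousLinearMap.adjoint A) (gradY g (A x) z)‖ ≤ ε
  grad_z : Metric.infDist (-gradZ g (A x) z) (normalCone Z z) ≤ ε

end

end BCADMM

namespace BCADMM

/-! ### Extended-real objectives and their real counterparts -/

/-! The proof is a Lyapunov argument for `potential`, the augmented Lagrangian plus multiples of the
last squared steps in `y` and `z`. The proximal terms make the `x`- and `y`-updates decrease the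
Lagrangian by squared step lengths, and strong convexity does the same for the `z`-update. Only the
multiplier update increases it, by exactly `β * ‖A x' - y'‖ ^ 2`. The optimality condition in `y`
says that the new multiplier is `∇_y g(y', z) + βy (y' - y)`. Hence the increment `β (A x' - y')` is
bounded, through a Lipschitz constant `L` of `∇_y g`, by the current `y`-step and the previous `y`-
and `z`-steps. For `β` large against `βy` and `L ^ 2 / σ` these absorb the increase
(`residual_sq_le`, `Step.invariant`).

The difficulty is that `L` exists only on compact subsets of `dom g`, whereas confinement to a
compact set is usually deduced from descent. `Invariant` breaks the circle by induction. Before the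
multiplier changes, descent alone bounds the objective, the steps in `x` and `z`, and the residual.
Coercivity controls `f x + g (A x, z)` rather than `f x + g (y, z)`; `Regular.exists_residual_bound`
passes from one to the other when the residual is small. So the new points lie in a fixed compact
set `K`, and the Lipschitz estimate applies.

The stationarity error is at most a constant times the lengths of the last steps and the residual
(`Step.isStationary`). The potential is bounded below, so their squares have a bounded sum, which
gives the `ε⁻²` rate. -/

lemma coe_add_coe_eq {h : ℝ≥0∞} (hh : h ≠ ⊤) (q : ℝ) :
    (h : EReal) + (q : EReal) = ((h.toReal + q : ℝ) : EReal) := by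
  rw [← EReal.coe_ennreal_toReal hh, ← EReal.coe_add]

lemma coe_top_add_coe (q : ℝ) : ((⊤ : ℝ≥0∞) : EReal) + (q : EReal) = ⊤ := by
  simp

/-- Feasibility propagates along the run by this fact: a point no worse than one of finite value has
finite value itself. -/
lemma toReal_add_le_of_coe_add_le {h₁ h₂ : ℝ≥0∞} {q₁ q₂ : ℝ} (h₂_fin : h₂ ≠ ⊤)
    (hle : (h₁ : EReal) + (q₁ : EReal) ≤ (h₂ : EReal) + (q₂ : EReal)) :
    h₁ ≠ ⊤ ∧ h₁.toReal + q₁ ≤ h₂.toReal + q₂ := by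
  rw [coe_add_coe_eq h₂_fin] at hle
  have h₁_fin : h₁ ≠ ⊤ := by
    rintro rfl
    rw [coe_top_add_coe, top_le_iff] at hle
    exact EReal.coe_ne_top _ hle
  rw [coe_add_coe_eq h₁_fin] at hle
  exact ⟨h₁_fin, EReal.coe_le_coe_iff.1 hle⟩

lemma isMinFilter_toReal_add {X : Type*} [TopologicalSpace X] {h : X → ℝ≥0∞} {q : X → ℝ}
    {l : Filter X} {a : X} (hl : l ≤ 𝓝 a) (hh : Continuous h) (ha : h a ≠ ⊤)
    (hmin : IsMinFilter (fun u => (h u : EReal) + (q u : EReal)) l a) :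
    IsMinFilter (fun u => (h u).toReal + q u) l a := by
  have hfin : ∀ᶠ u in l, h u ≠ ⊤ := hl (hh.continuousAt.eventually_ne ha)
  filter_upwards [hfin, hmin] with u hu hmu
  rw [coe_add_coe_eq ha, coe_add_coe_eq hu] at hmu
  exact EReal.coe_le_coe_iff.1 hmu

lemma continuous_coe_add_coe {X : Type*} [TopologicalSpace X] {h : X → ℝ≥0∞} {q : X → ℝ}
    (hh : Continuous h) (hq : Continuous q) :
    Continuous fun u => (h u : EReal) + (q u : EReal) := by
  rw [continuous_iff_continuousAt]
  intro u
  have := EReal.continuousAt_add (p := ((h u : EReal), (q u : EReal))) (by simp) (by simp)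
  exact this.comp (f := fun u => ((h u : EReal), (q u : EReal)))
    ((continuous_coe_ennreal_ereal.comp hh).prodMk
      (continuous_coe_real_ereal.comp hq)).continuousAt

/-! ### First-order conditions and quadratic growth for the subproblems. -/

section Subproblems

variable {n m l : ℕ} (f : Vec n → ℝ≥0∞) (g : Vec m × Vec l → ℝ≥0∞) (A : Vec n →L[ℝ] Vec m)

/-- The finite part of the augmented Lagrangian, as a function of the residual `A x - y`. -/
noncomputable def penalty (β : ℝ) (lam r : Vec m) : ℝ := β / 2 * ‖r‖ ^ 2 + ⟪lam, r⟫_ℝ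

/-- The real value of the augmented Lagrangian at points where it is finite. -/
noncomputable def realLagrangian (β : ℝ) (x : Vec n) (y : Vec m) (z : Vec l) (lam : Vec m) : ℝ :=
  (f x + g (y, z)).toReal + penalty β lam (A x - y)

lemma lagrangian_eq (β : ℝ) (x : Vec n) (y : Vec m) (z : Vec l) (lam : Vec m) :
    lagrangian f g A β x y z lam
      = ((f x + g (y, z) : ℝ≥0∞) : EReal) + (penalty β lam (A x - y) : EReal) := by
  rw [lagrangian, EReal.coe_ennreal_add, penalty]

lemma xObj_eq (βx β : ℝ) (xc : Vec n) (y : Vec m) (z : Vec l) (lam : Vec m) (x : Vec n) :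
    xObj f g A βx β xc y z lam x = ((f x + g (y, z) : ℝ≥0∞) : EReal)
      + ((penalty β lam (A x - y) + βx / 2 * ‖x - xc‖ ^ 2 : ℝ) : EReal) := by
  rw [xObj, lagrangian_eq, add_assoc, ← EReal.coe_add]

lemma yObj_eq (βy β : ℝ) (x : Vec n) (yc : Vec m) (z : Vec l) (lam : Vec m) (y : Vec m) :
    yObj f g A βy β x yc z lam y = ((f x + g (y, z) : ℝ≥0∞) : EReal)
      + ((penalty β lam (A x - y) + βy / 2 * ‖y - yc‖ ^ 2 : ℝ) : EReal) := by
  rw [yObj, lagrangian_eq, add_assoc, ← EReal.coe_add]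

variable {f g A}

lemma continuous_penalty (β : ℝ) (lam : Vec m) : Continuous (penalty β lam) := by
  unfold penalty; fun_prop

/-- Completing the square costs half of the quadratic term; the other half is kept to bound the
residual. -/
lemma penalty_lower_bound {β : ℝ} (hβ : 0 < β) (lam r : Vec m) :
    β / 4 * ‖r‖ ^ 2 - ‖lam‖ ^ 2 / β ≤ penalty β lam r := by
  have h1 : -(‖lam‖ * ‖r‖) ≤ ⟪lam, r⟫_ℝ := neg_le_of_abs_le (abs_real_inner_le_norm lam r)
  have h2 : ‖lam‖ * ‖r‖ ≤ β / 4 * ‖r‖ ^ 2 + ‖lam‖ ^ 2 / β := by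
    have : β / 4 * ‖r‖ ^ 2 + ‖lam‖ ^ 2 / β - ‖lam‖ * ‖r‖ = (β / 2 * ‖r‖ - ‖lam‖) ^ 2 / β := by
      field_simp; ring
    have := div_nonneg (sq_nonneg (β / 2 * ‖r‖ - ‖lam‖)) hβ.le
    linarith
  unfold penalty
  linarith

lemma hasFDerivAt_penalty (β : ℝ) (lam r : Vec m) :
    HasFDerivAt (penalty β lam) (innerSL ℝ (β • r + lam)) r := by
  have h1 : HasFDerivAt (fun r : Vec m => ‖r‖ ^ 2) (2 • innerSL ℝ r) r :=
    (hasStrictFDerivAt_norm_sq r).hasFDerivAt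
  have h2 : HasFDerivAt (fun r : Vec m => ⟪lam, r⟫_ℝ) (innerSL ℝ lam) r :=
    (innerSL ℝ lam).hasFDerivAt
  refine ((h1.const_mul (β / 2)).add h2).congr_fderiv ?_
  ext v
  simp
  ring

lemma hasFDerivAt_prox {k : ℕ} (b : ℝ) (uc u : Vec k) :
    HasFDerivAt (fun u : Vec k => b / 2 * ‖u - uc‖ ^ 2) (innerSL ℝ (b • (u - uc))) u := by
  have h1 : HasFDerivAt (fun u : Vec k => ‖u - uc‖ ^ 2) (2 • innerSL ℝ (u - uc)) u := by
    have := (hasStrictFDerivAt_norm_sq (u - uc)).hasFDerivAt.comp u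
      ((hasFDerivAt_id u).sub_const uc)
    simpa [Function.comp_def] using this
  refine (h1.const_mul (b / 2)).congr_fderiv ?_
  ext v
  simp
  ring

lemma hasFDerivAt_toReal {k : ℕ} {h : Vec k → ℝ≥0∞} {u : Vec k}
    (hd : DifferentiableAt ℝ (fun v => (h v).toReal) u) :
    HasFDerivAt (fun v => (h v).toReal) (innerSL ℝ (grad h u)) u := by
  have := hd.hasGradientAt.hasFDerivAt
  exact this

/-- First-order condition for a local minimizer of the sum of an extended-real function, a constant
and a differentiable function. -/
lemma grad_add_eq_zero {k : ℕ} {h : Vec k → ℝ≥0∞} {c : ℝ≥0∞} {q : Vec k → ℝ} {u v : Vec k}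
    (hh : Continuous h) (hd : DifferentiableAt ℝ (fun v => (h v).toReal) u)
    (hq : HasFDerivAt q (innerSL ℝ v) u) (hfin : h u ≠ ⊤) (hc : c ≠ ⊤)
    (hmin : IsLocalMin (fun u => ((h u + c : ℝ≥0∞) : EReal) + (q u : EReal)) u) :
    grad h u + v = 0 := by
  have hmin' : IsLocalMin (fun u => (h u + c).toReal + q u) u :=
    isMinFilter_toReal_add le_rfl (hh.add continuous_const) (ENNReal.add_ne_top.2 ⟨hfin, hc⟩) hmin
  have hev : (fun u => (h u + c).toReal + q u) =ᶠ[𝓝 u] fun u => (h u).toReal + c.toReal + q u := by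
    filter_upwards [hh.continuousAt.eventually_ne hfin] with w hw
    rw [ENNReal.toReal_add hw hc]
  have hder : HasFDerivAt (fun u => (h u).toReal + c.toReal + q u)
      (innerSL ℝ (grad h u) + innerSL ℝ v) u :=
    ((hasFDerivAt_toReal hd).add_const _).add hq
  have h0 := hmin'.hasFDerivAt_eq_zero (hder.congr_of_eventuallyEq hev)
  rw [← map_add] at h0
  have := congrArg (fun L => L (grad h u + v)) h0
  rw [← inner_self_eq_zero (𝕜 := ℝ)]
  exact this

lemma neg_grad_mem_normalCone {k : ℕ} {h : Vec k → ℝ≥0∞} {c : ℝ≥0∞} {q : ℝ} {S : Set (Vec k)}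
    {u : Vec k} (hS : Convex ℝ S) (hu : u ∈ S)
    (hh : Continuous h) (hd : DifferentiableAt ℝ (fun v => (h v).toReal) u)
    (hfin : h u ≠ ⊤) (hc : c ≠ ⊤)
    (hmin : IsMinOn (fun u => ((c + h u : ℝ≥0∞) : EReal) + (q : EReal)) S u) :
    -grad h u ∈ normalCone S u := by
  have hmin' : IsLocalMinOn (fun u => (c + h u).toReal + q) S u :=
    isMinFilter_toReal_add nhdsWithin_le_nhds (continuous_const.add hh)
      (ENNReal.add_ne_top.2 ⟨hc, hfin⟩) hmin.localize
  have hev : (fun u => (c + h u).toReal + q) =ᶠ[𝓝 u] fun u => c.toReal + (h u).toReal + q := by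
    filter_upwards [hh.continuousAt.eventually_ne hfin] with w hw
    rw [ENNReal.toReal_add hc hw]
  have hder : HasFDerivAt (fun u => c.toReal + (h u).toReal + q) (innerSL ℝ (grad h u)) u :=
    ((hasFDerivAt_toReal hd).const_add _).add_const _
  intro w hw
  have h0 := hmin'.hasFDerivWithinAt_nonneg
    (hder.congr_of_eventuallyEq hev).hasFDerivWithinAt
    (sub_mem_posTangentConeAt_of_segment_subset (hS.segment_subset hu hw))
  simp only [innerSL_apply_apply] at h0
  rw [inner_neg_left]
  linarith

lemma strongConvexOn_midpoint_le {k : ℕ} {S : Set (Vec k)} {σ : ℝ} {φ : Vec k → ℝ}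
    (h : StrongConvexOn S σ φ) {u v : Vec k} (hu : u ∈ S) (hv : v ∈ S) :
    φ ((1 / 2 : ℝ) • u + (1 / 2 : ℝ) • v) ≤ (φ u + φ v) / 2 - σ / 8 * ‖u - v‖ ^ 2 := by
  obtain ⟨-, h2⟩ := h
  have := h2 hu hv (a := 1 / 2) (b := 1 / 2) (by norm_num) (by norm_num) (by norm_num)
  simp only [smul_eq_mul] at this
  linarith

/-- Quadratic growth of a strongly convex function at its minimizer over a convex set. -/
lemma quadratic_growth {k : ℕ} {h : Vec k → ℝ≥0∞} {S : Set (Vec k)} {σ : ℝ} {u v : Vec k}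
    (hs : StrongConvexOn (dom h) σ fun v => (h v).toReal) (hS : Convex ℝ S) (hu : u ∈ S)
    (hv : v ∈ S) (hfin : h v ≠ ⊤) (hmin : ∀ w ∈ S, h w ≠ ⊤ → h u ≠ ⊤ ∧ (h u).toReal ≤ (h w).toReal) :
    (h u).toReal + σ / 4 * ‖v - u‖ ^ 2 ≤ (h v).toReal := by
  have hu_fin := (hmin v hv hfin).1
  -- Comparing the minimizer with the midpoint alone gives the factor `σ / 4` instead of the optimal
  -- `σ / 2`, and needs no limit along the segment.
  have h1 := strongConvexOn_midpoint_le hs (u := v) (v := u) hfin hu_fin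
  have h2 := (hmin ((1 / 2 : ℝ) • v + (1 / 2 : ℝ) • u)
    (hS hv hu (by norm_num) (by norm_num) (by norm_num))
    (hs.1 (x := v) hfin (y := u) hu_fin (by norm_num) (by norm_num) (by norm_num))).2
  linarith

end Subproblems

end BCADMM

/-! ### Optimality and descent relations of a single iteration. -/

namespace BCADMM

variable {n m l : ℕ}

/-- The standing assumptions on the problem `min f(x) + g(A x, z)` over `x` and `z ∈ Z`. -/
structure Regular (f : Vec n → ℝ≥0∞) (g : Vec m × Vec l → ℝ≥0∞) (A : Vec n →L[ℝ] Vec m)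
    (Z : Set (Vec l)) (σ : ℝ) : Prop where
  pos : 0 < σ
  f_cont : Continuous f
  f_diff : ∀ x ∈ dom f, DifferentiableAt ℝ (fun u => (f u).toReal) x
  g_cont : Continuous g
  g_diff : ContDiffOn ℝ 2 (fun p => (g p).toReal) (dom g)
  coercive : Coercive (fun p : Vec n × Vec l => f p.1 + g (A p.1, p.2))
  strong : ∀ y, StrongConvexOn (dom fun z => g (y, z)) σ (fun z => (g (y, z)).toReal)
  convex : Convex ℝ Z

variable {f : Vec n → ℝ≥0∞} {g : Vec m × Vec l → ℝ≥0∞} {A : Vec n →L[ℝ] Vec m}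
  {Z : Set (Vec l)} {σ : ℝ}

namespace Regular

lemma isOpen_dom (H : Regular f g A Z σ) : IsOpen (dom g) :=
  isOpen_ne_fun H.g_cont continuous_const

lemma differentiableAt_g (H : Regular f g A Z σ) {p : Vec m × Vec l} (hp : g p ≠ ⊤) :
    DifferentiableAt ℝ (fun p => (g p).toReal) p :=
  (H.g_diff.contDiffAt (H.isOpen_dom.mem_nhds hp)).differentiableAt (by norm_num)

lemma hasFDerivAt_g_fst (H : Regular f g A Z σ) {y : Vec m} {z : Vec l} (hp : g (y, z) ≠ ⊤) :
    HasFDerivAt (fun y => (g (y, z)).toReal)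
      ((fderiv ℝ (fun p => (g p).toReal) (y, z)).comp (ContinuousLinearMap.inl ℝ _ _)) y :=
  (H.differentiableAt_g hp).hasFDerivAt.comp (f := fun y => (y, z)) y (hasFDerivAt_prodMk_left y z)

lemma hasFDerivAt_g_snd (H : Regular f g A Z σ) {y : Vec m} {z : Vec l} (hp : g (y, z) ≠ ⊤) :
    HasFDerivAt (fun z => (g (y, z)).toReal)
      ((fderiv ℝ (fun p => (g p).toReal) (y, z)).comp (ContinuousLinearMap.inr ℝ _ _)) z :=
  (H.differentiableAt_g hp).hasFDerivAt.comp (f := fun z => (y, z)) z (hasFDerivAt_prodMk_right y z)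

end Regular

/-- What one iteration of BC-ADMM yields when it starts from a point with finite objective. -/
structure Step (f : Vec n → ℝ≥0∞) (g : Vec m × Vec l → ℝ≥0∞) (A : Vec n →L[ℝ] Vec m)
    (Z : Set (Vec l)) (σ βx βy β : ℝ) (x : Vec n) (y : Vec m) (z : Vec l) (lam : Vec m)
    (x' : Vec n) (y' : Vec m) (z' : Vec l) : Prop where
  f_fin : f x' ≠ ⊤
  g_fin : g (y', z) ≠ ⊤
  g_fin' : g (y', z') ≠ ⊤
  descent_xy : realLagrangian f g A β x' y' z lam + βx / 2 * ‖x' - x‖ ^ 2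
    + βy / 2 * ‖y' - y‖ ^ 2 ≤ realLagrangian f g A β x y z lam
  descent_z : realLagrangian f g A β x' y' z' lam + σ / 4 * ‖z' - z‖ ^ 2
    ≤ realLagrangian f g A β x' y' z lam
  opt_x : grad f x' + (ContinuousLinearMap.adjoint A (β • (A x' - y) + lam)
    + βx • (x' - x)) = 0
  opt_y : lam + β • (A x' - y') = gradY g y' z + βy • (y' - y)
  opt_z : -gradZ g y' z' ∈ normalCone Z z'

lemma IsRun.step (H : Regular f g A Z σ) {βx βy β : ℝ} {x₀ : Vec n} {x : ℕ → Vec n}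
    {y : ℕ → Vec m} {z : ℕ → Vec l} {lam : ℕ → Vec m}
    (R : IsRun f g A Z βx βy β x₀ x y z lam) {k : ℕ} (hzk : z k ∈ Z) (hf : f (x k) ≠ ⊤)
    (hg : g (y k, z k) ≠ ⊤) :
    Step f g A Z σ βx βy β (x k) (y k) (z k) (lam k) (x (k + 1)) (y (k + 1)) (z (k + 1)) := by
  have hx_desc := R.x_descent k
  have hx_min := R.x_locMin k
  have hy_desc := R.y_min k (mem_univ (y k))
  have hy_min := (R.y_min k).isLocalMin univ_mem
  have hz_min := R.z_min k
  rw [funext (xObj_eq f g A βx β (x k) (y k) (z k) (lam k))] at hx_desc hx_min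
  rw [funext (yObj_eq f g A βy β (x (k + 1)) (y k) (z k) (lam k))] at hy_min
  simp only [mem_ofPred_eq, yObj_eq] at hy_desc
  simp only [lagrangian_eq] at hz_min
  set X := x (k + 1)
  set Y := y (k + 1)
  set W := z (k + 1)
  obtain ⟨hfin1, hx_le⟩ := toReal_add_le_of_coe_add_le (ENNReal.add_ne_top.2 ⟨hf, hg⟩) hx_desc
  have hX : f X ≠ ⊤ := (ENNReal.add_ne_top.1 hfin1).1
  obtain ⟨hfin2, hy_le⟩ := toReal_add_le_of_coe_add_le hfin1 hy_desc
  have hY : g (Y, z k) ≠ ⊤ := (ENNReal.add_ne_top.1 hfin2).2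
  have hz_le : ∀ w ∈ Z, g (Y, w) ≠ ⊤ →
      g (Y, W) ≠ ⊤ ∧ (g (Y, W)).toReal ≤ (g (Y, w)).toReal := by
    intro w hw hwfin
    obtain ⟨h1, h2⟩ := toReal_add_le_of_coe_add_le (ENNReal.add_ne_top.2 ⟨hX, hwfin⟩) (hz_min hw)
    have h3 := (ENNReal.add_ne_top.1 h1).2
    rw [ENNReal.toReal_add hX h3, ENNReal.toReal_add hX hwfin] at h2
    exact ⟨h3, by linarith⟩
  have hW : g (Y, W) ≠ ⊤ := (hz_le _ hzk hY).1
  have hgrowth := quadratic_growth (h := fun w => g (Y, w)) (H.strong Y) H.convex (R.z_mem k) hzk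
    hY hz_le
  refine ⟨hX, hY, hW, ?_, ?_, ?_, ?_, ?_⟩
  · simp only [realLagrangian]
    simp only [sub_self, norm_zero] at hx_le hy_le
    linarith
  · simp only [realLagrangian, ENNReal.toReal_add hX hW, ENNReal.toReal_add hX hY]
    rw [norm_sub_rev]
    linarith
  · refine grad_add_eq_zero (q := fun u => penalty β (lam k) (A u - y k)
      + βx / 2 * ‖u - x k‖ ^ 2) H.f_cont (H.f_diff _ hX) ?_ hX hg hx_min
    have h1 := (hasFDerivAt_penalty β (lam k) (A X - y k)).comp X
      (A.hasFDerivAt.sub_const (y k) : HasFDerivAt (fun u => A u - y k) A X)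
    refine (h1.add (hasFDerivAt_prox βx (x k) X)).congr_fderiv ?_
    ext v
    simp only [add_apply, ContinuousLinearMap.comp_apply, innerSL_apply_apply,
      map_add, ContinuousLinearMap.adjoint_inner_left]
  · have hq : HasFDerivAt (fun u => penalty β (lam k) (A X - u) + βy / 2 * ‖u - y k‖ ^ 2)
        (innerSL ℝ (-(β • (A X - Y) + lam k) + βy • (Y - y k))) Y := by
      have h1 := (hasFDerivAt_penalty β (lam k) (A X - Y)).comp Y
        ((hasFDerivAt_id Y).const_sub (A X))
      refine (h1.add (hasFDerivAt_prox βy (y k) Y)).congr_fderiv ?_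
      ext v
      simp
    simp only [add_comm (f X)] at hy_min
    have h0 := grad_add_eq_zero (h := fun u => g (u, z k))
      (H.g_cont.comp (Continuous.prodMk_left _)) (H.hasFDerivAt_g_fst hY).differentiableAt hq hY
      hX hy_min
    rw [gradY]
    rw [← sub_eq_zero, ← neg_eq_zero, ← h0]
    abel
  · exact neg_grad_mem_normalCone (h := fun w => g (Y, w)) H.convex (R.z_mem k)
      (H.g_cont.comp (Continuous.prodMk_right _)) (H.hasFDerivAt_g_snd hW).differentiableAt hW hX
      hz_min

lemma IsRun.neg_gradZ_zero_mem (H : Regular f g A Z σ) {βx βy β : ℝ} {x₀ : Vec n} {x : ℕ → Vec n}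
    {y : ℕ → Vec m} {z : ℕ → Vec l} {lam : ℕ → Vec m}
    (R : IsRun f g A Z βx βy β x₀ x y z lam) (hg : g (y 0, z 0) ≠ ⊤) :
    -gradZ g (y 0) (z 0) ∈ normalCone Z (z 0) := by
  refine neg_grad_mem_normalCone (h := fun w => g (y 0, w)) (c := 0) (q := 0) H.convex R.z_zero_mem
      (H.g_cont.comp (Continuous.prodMk_right _)) (H.hasFDerivAt_g_snd hg).differentiableAt hg
      (by simp) ?_
  intro w hw
  have := R.z_zero_min hw
  simpa using this

/-! ### Existence of iterates -/

lemma exists_isMinOn_coe_add {k : ℕ} {h : Vec k → ℝ≥0∞} {q : Vec k → ℝ} {S : Set (Vec k)}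
    (hh : Continuous h) (hq : Continuous q) (hS : IsClosed S) (hne : S.Nonempty)
    (hcoer : ∀ u ∈ S, h u ≠ ⊤ → ∃ ρ : ℝ, ∀ v ∈ S, h v ≠ ⊤ → (h v).toReal + q v ≤ (h u).toReal + q u →
      ‖v‖ ≤ ρ) :
    ∃ u ∈ S, IsMinOn (fun u => (h u : EReal) + (q u : EReal)) S u := by
  by_cases hfin : ∃ u ∈ S, h u ≠ ⊤
  · obtain ⟨u, hu, hu_fin⟩ := hfin
    obtain ⟨ρ, hρ⟩ := hcoer u hu hu_fin
    refine (continuous_coe_add_coe hh hq).continuousOn.exists_isMinOn' hS hu ?_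
    have hev : ∀ᶠ v in cocompact (Vec k) ⊓ 𝓟 S, v ∈ (Metric.closedBall 0 ρ)ᶜ ∩ S :=
      inter_mem_inf (isCompact_closedBall _ _).compl_mem_cocompact (mem_principal_self S)
    filter_upwards [hev] with v hv
    by_contra! hlt
    obtain ⟨h1, h2⟩ := toReal_add_le_of_coe_add_le hu_fin hlt.le
    exact hv.1 (by simpa using hρ v hv.2 h1 h2)
  · push Not at hfin
    obtain ⟨u, hu⟩ := hne
    refine ⟨u, hu, fun v hv => ?_⟩
    simp only [mem_ofPred_eq, hfin u hu, hfin v hv, coe_top_add_coe, le_refl]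

lemma norm_le_of_prox_le {k : ℕ} {b M : ℝ} (hb : 0 < b) {u uc : Vec k}
    (h : b / 2 * ‖u - uc‖ ^ 2 ≤ M) : ‖u‖ ≤ 1 + 2 * M / b + ‖uc‖ := by
  have h1 : ‖u - uc‖ ^ 2 ≤ 2 * M / b := by rw [le_div_iff₀ hb]; linarith
  have h2 : ‖u‖ ≤ ‖u - uc‖ + ‖uc‖ := by simpa using norm_add_le (u - uc) uc
  -- The inequality `t ≤ t ^ 2 + 1 / 4` replaces a square root.
  nlinarith [sq_nonneg (‖u - uc‖ - 1 / 2)]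

lemma exists_isMinOn_prox {k : ℕ} {h : Vec k → ℝ≥0∞} {q : Vec k → ℝ} {b c : ℝ} (hb : 0 < b)
    (uc : Vec k) (hh : Continuous h) (hq : Continuous q) (hqc : ∀ u, c ≤ q u) :
    ∃ u, IsMinOn (fun u => (h u : EReal) + ((q u + b / 2 * ‖u - uc‖ ^ 2 : ℝ) : EReal)) univ u := by
  obtain ⟨u, -, hu⟩ := exists_isMinOn_coe_add (q := fun u => q u + b / 2 * ‖u - uc‖ ^ 2) hh
    (by fun_prop) isClosed_univ univ_nonempty (fun u _ _ =>
      ⟨1 + 2 * ((h u).toReal + (q u + b / 2 * ‖u - uc‖ ^ 2) - c) / b + ‖uc‖, fun v _ _ hv =>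
      norm_le_of_prox_le hb (by
        have := hqc v
        have := ENNReal.toReal_nonneg (a := h v)
        linarith)⟩)
  exact ⟨u, hu⟩

/-- Sublevel sets are bounded because `h` is nonnegative at the midpoint of `u` and `v`, so `σ / 8 *
‖v - u‖ ^ 2` is at most the average of the two values. -/
lemma exists_isMinOn_strong {k : ℕ} {h : Vec k → ℝ≥0∞} {c : ℝ≥0∞} {q : ℝ} {S : Set (Vec k)} (hσ : 0 < σ)
    (hc : c ≠ ⊤) (hh : Continuous h) (hs : StrongConvexOn (dom h) σ fun v => (h v).toReal)
    (hS : IsClosed S) (hne : S.Nonempty) :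
    ∃ u ∈ S, IsMinOn (fun u => ((c + h u : ℝ≥0∞) : EReal) + (q : EReal)) S u := by
  refine exists_isMinOn_coe_add (q := fun _ => q) (h := fun u => c + h u) (by fun_prop)
    continuous_const hS hne fun u hu hu_fin =>
      ⟨1 + 2 * (2 * (h u).toReal) / (σ / 2) + ‖u‖, fun v hv hv_fin hle =>
        norm_le_of_prox_le (by positivity) ?_⟩
  have h1 := (ENNReal.add_ne_top.1 hu_fin).2
  have h2 := (ENNReal.add_ne_top.1 hv_fin).2
  rw [ENNReal.toReal_add hc h1, ENNReal.toReal_add hc h2] at hle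
  have h3 := strongConvexOn_midpoint_le hs (u := v) (v := u) h2 h1
  have := ENNReal.toReal_nonneg (a := h ((1 / 2 : ℝ) • v + (1 / 2 : ℝ) • u))
  linarith

lemma neg_le_penalty {β : ℝ} (hβ : 0 < β) (lam r : Vec m) :
    -(‖lam‖ ^ 2 / β) ≤ penalty β lam r := by
  have := penalty_lower_bound hβ lam r
  have : 0 ≤ β / 4 * ‖r‖ ^ 2 := by positivity
  linarith

lemma exists_x_minimizer (H : Regular f g A Z σ) {βx β : ℝ} (hβx : 0 < βx) (hβ : 0 < β)
    (x : Vec n) (y : Vec m) (z : Vec l) (lam : Vec m) :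
    ∃ x', IsMinOn (xObj f g A βx β x y z lam) univ x' := by
  have := exists_isMinOn_prox (h := fun u => f u + g (y, z)) (q := fun u => penalty β lam (A u - y))
    hβx x (H.f_cont.add continuous_const) ((continuous_penalty β lam).comp (by fun_prop))
    fun u => neg_le_penalty hβ lam _
  simpa only [← xObj_eq] using this

lemma exists_y_minimizer (H : Regular f g A Z σ) {βy β : ℝ} (hβy : 0 < βy) (hβ : 0 < β)
    (x : Vec n) (y : Vec m) (z : Vec l) (lam : Vec m) :
    ∃ y', IsMinOn (yObj f g A βy β x y z lam) univ y' := by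
  have := exists_isMinOn_prox (h := fun u => f x + g (u, z)) (q := fun u => penalty β lam (A x - u))
    hβy y (continuous_const.add (H.g_cont.comp (Continuous.prodMk_left _)))
    ((continuous_penalty β lam).comp (by fun_prop))
    fun u => neg_le_penalty hβ lam _
  simpa only [← yObj_eq] using this

lemma exists_z_minimizer (H : Regular f g A Z σ) (hZ : IsClosed Z) (hne : Z.Nonempty) (β : ℝ)
    (x : Vec n) (y : Vec m) (lam : Vec m) :
    ∃ z' ∈ Z, IsMinOn (fun w => lagrangian f g A β x y w lam) Z z' := by
  -- The update map is chosen on all states, including infeasible ones; there the objective is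
  -- constantly `⊤` and any point of `Z` is a minimizer.
  by_cases hx : f x = ⊤
  · obtain ⟨w, hw⟩ := hne
    refine ⟨w, hw, fun v _ => ?_⟩
    simp only [mem_ofPred_eq, lagrangian_eq, hx, top_add, coe_top_add_coe, le_refl]
  · have := exists_isMinOn_strong (h := fun w => g (y, w)) (c := f x)
      (q := penalty β lam (A x - y)) H.pos hx (H.g_cont.comp (Continuous.prodMk_right _))
      (H.strong y) hZ hne
    simpa only [← lagrangian_eq] using this

theorem exists_isRun (H : Regular f g A Z σ) (hZ : IsClosed Z) (hne : Z.Nonempty) {βx βy β : ℝ}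
    (hβx : 0 < βx) (hβy : 0 < βy) (hβ : 0 < β) (x₀ : Vec n) :
    ∃ x y z lam, IsRun f g A Z βx βy β x₀ x y z lam := by
  choose X hX using fun s : Vec n × Vec m × Vec l × Vec m =>
    exists_x_minimizer H hβx hβ s.1 s.2.1 s.2.2.1 s.2.2.2
  choose Y hY using fun (x' : Vec n) (s : Vec n × Vec m × Vec l × Vec m) =>
    exists_y_minimizer H hβy hβ x' s.2.1 s.2.2.1 s.2.2.2
  choose W hWmem hW using fun (x' : Vec n) (y' lam : Vec m) =>
    exists_z_minimizer H hZ hne β x' y' lam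
  obtain ⟨z₀, hz₀, hz₀min⟩ := exists_isMinOn_strong (h := fun w => g (A x₀, w)) (c := 0) (q := 0)
    H.pos (by simp) (H.g_cont.comp (Continuous.prodMk_right _)) (H.strong (A x₀)) hZ hne
  let next : Vec n × Vec m × Vec l × Vec m → Vec n × Vec m × Vec l × Vec m := fun s =>
    (X s, Y (X s) s, W (X s) (Y (X s) s) s.2.2.2, s.2.2.2 + β • (A (X s) - Y (X s) s))
  let s : ℕ → Vec n × Vec m × Vec l × Vec m := fun k =>
    next^[k] (x₀, A x₀, z₀, gradY g (A x₀) z₀)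
  have hs : ∀ k, s (k + 1) = next (s k) := fun k => Function.iterate_succ_apply' ..
  refine ⟨fun k => (s k).1, fun k => (s k).2.1, fun k => (s k).2.2.1, fun k => (s k).2.2.2,
    rfl, rfl, hz₀, ?_, rfl, ?_, ?_, ?_, ?_, ?_, ?_⟩
  · intro w hw
    have := hz₀min hw
    simp only [mem_ofPred_eq, zero_add, EReal.coe_zero, add_zero] at this
    exact EReal.coe_ennreal_le_coe_ennreal_iff.1 this
  all_goals intro k; simp only [hs k]
  · exact (hX (s k)).isLocalMin univ_mem
  · exact hX (s k) (mem_univ _)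
  · exact hY _ (s k)
  · exact hWmem _ _ _
  · exact hW _ _ _
  · rfl

end BCADMM

namespace BCADMM

variable {n m l : ℕ} {f : Vec n → ℝ≥0∞} {g : Vec m × Vec l → ℝ≥0∞} {A : Vec n →L[ℝ] Vec m}
  {Z : Set (Vec l)} {σ : ℝ}

/-! ### Uniform bounds near a sublevel set -/

/-- Since `K` need not be convex, the mean value inequality is not available on it; a locally
Lipschitz map on a compact set is nevertheless Lipschitz there. -/
lemma lipschitz_and_bounded_of_contDiffOn {E F : Type*} [NormedAddCommGroup E] [NormedSpace ℝ E]
    [NormedAddCommGroup F] [NormedSpace ℝ F] {φ : E → F} {U K : Set E} (hU : IsOpen U)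
    (hφ : ContDiffOn ℝ 1 φ U) (hK : IsCompact K) (hKU : K ⊆ U) :
    ∃ L G : ℝ, 0 ≤ L ∧ 0 ≤ G ∧ (∀ p ∈ K, ∀ q ∈ K, ‖φ p - φ q‖ ≤ L * ‖p - q‖) ∧
      ∀ p ∈ K, ‖φ p‖ ≤ G := by
  have hlip : LocallyLipschitzOn K φ := by
    intro p hp
    obtain ⟨C, t, ht, h⟩ := (hφ.contDiffAt (hU.mem_nhds (hKU hp))).exists_lipschitzOnWith
    exact ⟨C, t, mem_nhdsWithin_of_mem_nhds ht, h⟩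
  obtain ⟨L, hL⟩ := hlip.exists_lipschitzOnWith_of_compact hK
  obtain ⟨G, hG⟩ := hK.exists_bound_of_continuousOn (hφ.continuousOn.mono hKU)
  refine ⟨L, max G 0, L.2, le_max_right _ _, fun p hp q hq => ?_, fun p hp =>
    (hG p hp).trans (le_max_left _ _)⟩
  rw [← dist_eq_norm, ← dist_eq_norm]
  exact hL.dist_le_mul p hp q hq

namespace Regular

lemma contDiffOn_fderiv (H : Regular f g A Z σ) :
    ContDiffOn ℝ 1 (fderiv ℝ fun p => (g p).toReal) (dom g) :=
  H.g_diff.fderiv_of_isOpen H.isOpen_dom (by norm_num)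

lemma contDiffOn_gradY (H : Regular f g A Z σ) :
    ContDiffOn ℝ 1 (fun p : Vec m × Vec l => gradY g p.1 p.2) (dom g) := by
  have h1 : ContDiffOn ℝ 1 (fun p => (InnerProductSpace.toDual ℝ (Vec m)).symm
      ((fderiv ℝ (fun p => (g p).toReal) p).comp (ContinuousLinearMap.inl ℝ (Vec m) (Vec l))))
      (dom g) :=
    (InnerProductSpace.toDual ℝ (Vec m)).symm.toContinuousLinearEquiv.contDiff.comp_contDiffOn
      (H.contDiffOn_fderiv.clm_comp contDiffOn_const)
  refine h1.congr fun p hp => ?_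
  rw [gradY, grad, gradient, (H.hasFDerivAt_g_fst hp).fderiv]

lemma contDiffOn_gradZ (H : Regular f g A Z σ) :
    ContDiffOn ℝ 1 (fun p : Vec m × Vec l => gradZ g p.1 p.2) (dom g) := by
  have h1 : ContDiffOn ℝ 1 (fun p => (InnerProductSpace.toDual ℝ (Vec l)).symm
      ((fderiv ℝ (fun p => (g p).toReal) p).comp (ContinuousLinearMap.inr ℝ (Vec m) (Vec l))))
      (dom g) :=
    (InnerProductSpace.toDual ℝ (Vec l)).symm.toContinuousLinearEquiv.contDiff.comp_contDiffOn
      (H.contDiffOn_fderiv.clm_comp contDiffOn_const)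
  refine h1.congr fun p hp => ?_
  rw [gradZ, grad, gradient, (H.hasFDerivAt_g_snd hp).fderiv]

lemma exists_sublevel_bound (H : Regular f g A Z σ) (c : ℝ) :
    ∃ R : ℝ, 0 ≤ R ∧ ∀ x z, f x + g (A x, z) ≤ ENNReal.ofReal c → ‖x‖ ≤ R ∧ ‖z‖ ≤ R := by
  have hev := H.coercive.eventually (lt_mem_nhds (ENNReal.ofReal_lt_top (r := c)))
  obtain ⟨t, ht, hsub⟩ := mem_cocompact.1 hev
  obtain ⟨R, hR⟩ := ht.isBounded.exists_norm_le
  refine ⟨max R 0, le_max_right _ _, fun x z hxz => ?_⟩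
  have hmem : (x, z) ∈ t := by
    by_contra hnot
    exact absurd hxz (not_le.2 (hsub hnot))
  have := (hR _ hmem).trans (le_max_left R 0)
  exact ⟨(norm_fst_le (x, z)).trans this, (norm_snd_le (x, z)).trans this⟩

/-- On bounded sets, a small residual `A x - y` changes the objective by less than one. -/
lemma exists_residual_bound (H : Regular f g A Z σ) {c : ℝ} (hc : 0 ≤ c) (a b : ℝ) :
    ∃ δ : ℝ, 0 < δ ∧ ∀ x y z, ‖x‖ ≤ a → ‖z‖ ≤ b → ‖A x - y‖ ≤ δ →
      f x + g (y, z) ≤ ENNReal.ofReal (c + 1) → f x + g (A x, z) ≤ ENNReal.ofReal (c + 2) := by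
  -- `S` collects the violations as triples `(x, z, r)` with `r = A x - y`. It is compact and
  -- contains no point with `r = 0`, so `‖r‖` has a positive lower bound `η` on it.
  let S : Set (Vec n × Vec l × Vec m) :=
    (Metric.closedBall 0 a ×ˢ Metric.closedBall 0 b ×ˢ Metric.closedBall 0 1) ∩
      ({p | f p.1 + g (A p.1 - p.2.2, p.2.1) ≤ ENNReal.ofReal (c + 1)} ∩
        {p | ENNReal.ofReal (c + 2) ≤ f p.1 + g (A p.1, p.2.1)})
  have hf := H.f_cont
  have hg := H.g_cont
  have hS : IsCompact S := by
    refine ((isCompact_closedBall _ _).prod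
      ((isCompact_closedBall _ _).prod (isCompact_closedBall _ _))).inter_right (.inter ?_ ?_)
    · exact isClosed_le (by fun_prop) continuous_const
    · exact isClosed_le continuous_const (by fun_prop)
  have hlt : ENNReal.ofReal (c + 1) < ENNReal.ofReal (c + 2) :=
    (ENNReal.ofReal_lt_ofReal_iff (by linarith)).2 (by linarith)
  obtain ⟨η, hη, hSη⟩ : ∃ η : ℝ, 0 < η ∧ ∀ p ∈ S, η ≤ ‖p.2.2‖ := by
    rcases S.eq_empty_or_nonempty with hemp | hne
    · exact ⟨1, one_pos, by simp [hemp]⟩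
    · obtain ⟨p, hp, hmin⟩ := hS.exists_isMinOn hne
        (f := fun p : Vec n × Vec l × Vec m => ‖p.2.2‖) (by fun_prop)
      refine ⟨‖p.2.2‖, norm_pos_iff.2 fun h0 => ?_, fun q hq => hmin hq⟩
      have h1 : f p.1 + g (A p.1 - p.2.2, p.2.1) ≤ ENNReal.ofReal (c + 1) := hp.2.1
      rw [h0, sub_zero] at h1
      exact absurd (hlt.trans_le (hp.2.2.trans h1)) (lt_irrefl _)
  refine ⟨min 1 (η / 2), by positivity, fun x y z hx hz hr hle => ?_⟩
  by_contra! hgt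
  have := hSη (x, z, A x - y) ⟨⟨by simpa using hx, by simpa using hz,
    by simpa using hr.trans (min_le_left _ _)⟩, by simpa using hle, hgt.le⟩
  have := hr.trans (min_le_right _ _)
  simp only at *
  linarith

end Regular

/-- Bounds on `∇g` on a set `K` of feasible points `(y, z)` that captures every point which is
reached by a short step from the sublevel set `f x + g (A x, z) ≤ F + 2`. -/
structure Bounds (f : Vec n → ℝ≥0∞) (g : Vec m × Vec l → ℝ≥0∞) (A : Vec n →L[ℝ] Vec m)
    (σ : ℝ) (F G L δ : ℝ) (K : Set (Vec m × Vec l)) : Prop where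
  F_nonneg : 0 ≤ F
  G_nonneg : 0 ≤ G
  L_nonneg : 0 ≤ L
  δ_pos : 0 < δ
  mem : ∀ x z, f x + g (A x, z) ≤ ENNReal.ofReal (F + 2) → (A x, z) ∈ K
  step : ∀ x z x' y' z', f x + g (A x, z) ≤ ENNReal.ofReal (F + 2) → ‖x' - x‖ ≤ 1 →
    σ * ‖z' - z‖ ^ 2 ≤ 4 * (F + 1) → ‖A x' - y'‖ ≤ δ →
    f x' + g (y', z') ≤ ENNReal.ofReal (F + 1) →
    (y', z') ∈ K ∧ f x' + g (A x', z') ≤ ENNReal.ofReal (F + 2)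
  gradY_le : ∀ p ∈ K, ‖gradY g p.1 p.2‖ ≤ G
  gradY_lip : ∀ p ∈ K, ∀ q ∈ K, ‖gradY g p.1 p.2 - gradY g q.1 q.2‖
    ≤ L * (‖p.1 - q.1‖ + ‖p.2 - q.2‖)
  gradZ_lip : ∀ p ∈ K, ∀ q ∈ K, ‖gradZ g p.1 p.2 - gradZ g q.1 q.2‖
    ≤ L * (‖p.1 - q.1‖ + ‖p.2 - q.2‖)

lemma norm_prod_le_add {E F : Type*} [SeminormedAddCommGroup E] [SeminormedAddCommGroup F]
    (p : E × F) : ‖p‖ ≤ ‖p.1‖ + ‖p.2‖ := by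
  rw [Prod.norm_def]
  exact max_le_add_of_nonneg (norm_nonneg _) (norm_nonneg _)

lemma Regular.exists_bounds (H : Regular f g A Z σ) {F : ℝ} (hF : 0 ≤ F) :
    ∃ (G L δ : ℝ) (K : Set (Vec m × Vec l)), Bounds f g A σ F G L δ K := by
  have hσ := H.pos
  obtain ⟨R, hR0, hR⟩ := H.exists_sublevel_bound (F + 2)
  -- `ρ` bounds any `z`-step with `σ * ‖z' - z‖ ^ 2 ≤ 4 * (F + 1)`, again by `t ≤ t ^ 2 + 1 / 4`.
  let ρ : ℝ := 4 * (F + 1) / σ + 1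
  obtain ⟨δ, hδ, hres⟩ := H.exists_residual_bound hF (R + 1) (R + ρ)
  have hρ : 0 ≤ ρ := by positivity
  -- The balls make `K` bounded; the closed sublevel condition keeps it inside `dom g`.
  let K : Set (Vec m × Vec l) :=
    (Metric.closedBall 0 (‖A‖ * (R + 1) + δ) ×ˢ Metric.closedBall 0 (R + ρ)) ∩
      {p | g p ≤ ENNReal.ofReal (F + 2)}
  have hK : IsCompact K :=
    ((isCompact_closedBall _ _).prod (isCompact_closedBall _ _)).inter_right
      (isClosed_le H.g_cont continuous_const)
  have hKdom : K ⊆ dom g := fun p hp => (hp.2.trans_lt ENNReal.ofReal_lt_top).ne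
  obtain ⟨L₁, G, hL₁, hG, hY, hYG⟩ :=
    lipschitz_and_bounded_of_contDiffOn H.isOpen_dom H.contDiffOn_gradY hK hKdom
  obtain ⟨L₂, -, hL₂, -, hZ, -⟩ :=
    lipschitz_and_bounded_of_contDiffOn H.isOpen_dom H.contDiffOn_gradZ hK hKdom
  refine ⟨G, L₁ + L₂, δ, K, hF, hG, by positivity, hδ, ?_, ?_, hYG, ?_, ?_⟩
  · intro x z hxz
    obtain ⟨h1, h2⟩ := hR x z hxz
    refine ⟨⟨?_, ?_⟩, le_add_self.trans hxz⟩
    · rw [mem_closedBall_zero_iff]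
      have h3 : ‖A x‖ ≤ ‖A‖ * R := A.le_opNorm_of_le h1
      have := norm_nonneg A
      simp only
      linarith
    · rw [mem_closedBall_zero_iff]
      simp only
      linarith
  · intro x z x' y' z' hxz hx hz hr hle
    obtain ⟨h1, h2⟩ := hR x z hxz
    have hx' : ‖x'‖ ≤ R + 1 := by
      have : ‖x'‖ ≤ ‖x' - x‖ + ‖x‖ := by simpa using norm_add_le (x' - x) x
      linarith
    have hdz : ‖z' - z‖ ≤ ρ := by
      have : ‖z' - z‖ ^ 2 ≤ 4 * (F + 1) / σ := by rw [le_div_iff₀ hσ]; linarith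
      simp only [ρ]
      nlinarith [sq_nonneg (‖z' - z‖ - 1 / 2)]
    have hz' : ‖z'‖ ≤ R + ρ := by
      have : ‖z'‖ ≤ ‖z' - z‖ + ‖z‖ := by simpa using norm_add_le (z' - z) z
      linarith
    refine ⟨⟨⟨?_, ?_⟩, ?_⟩, hres _ _ _ hx' hz' hr hle⟩
    · rw [mem_closedBall_zero_iff]
      have h3 : ‖A x'‖ ≤ ‖A‖ * (R + 1) := A.le_opNorm_of_le hx'
      have h4 : ‖y'‖ ≤ ‖A x'‖ + ‖A x' - y'‖ := by
        simpa using norm_sub_le (A x') (A x' - y')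
      simp only
      linarith
    · rw [mem_closedBall_zero_iff]
      exact hz'
    · exact (le_add_self.trans hle).trans (ENNReal.ofReal_le_ofReal (by linarith))
  · intro p hp q hq
    have h1 := hY p hp q hq
    have h2 := norm_prod_le_add (p - q)
    have h3 := norm_nonneg (p - q)
    simp only [Prod.fst_sub, Prod.snd_sub] at h2
    nlinarith
  · intro p hp q hq
    have h1 := hZ p hp q hq
    have h2 := norm_prod_le_add (p - q)
    have h3 := norm_nonneg (p - q)
    simp only [Prod.fst_sub, Prod.snd_sub] at h2
    nlinarith

end BCADMM

namespace BCADMM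

variable {n m l : ℕ} {f : Vec n → ℝ≥0∞} {g : Vec m × Vec l → ℝ≥0∞} {A : Vec n →L[ℝ] Vec m}
  {Z : Set (Vec l)} {σ : ℝ}

/-! ### Descent -/

/-- The requirements on the parameters of BC-ADMM. -/
structure Admissible (σ F G L δ βx βy β : ℝ) : Prop where
  βx_pos : 0 < βx
  βy_pos : 0 < βy
  β_pos : 0 < β
  x_short : 2 * (F + 1) ≤ βx
  residual_short : 4 * (F + 1) ≤ β * δ ^ 2
  G_le : 4 * G ^ 2 ≤ β
  L_le : L ≤ βy
  L_sq_le : 48 * L ^ 2 ≤ σ * β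
  βy_le : 96 * βy ≤ β

lemma exists_admissible {F G L δ : ℝ} (hσ : 0 < σ) (hF : 0 ≤ F) (hL : 0 ≤ L) (hδ : 0 < δ) :
    ∃ C : ℝ, 0 < C ∧ ∀ βx βy β : ℝ, C ≤ βx → C ≤ βy → C * βy ≤ β →
      Admissible σ F G L δ βx βy β := by
  have p1 : 0 ≤ 4 * (F + 1) / δ ^ 2 := by positivity
  have p2 : 0 ≤ 48 * L ^ 2 / σ := by positivity
  have p3 : 0 ≤ 4 * G ^ 2 := by positivity
  refine ⟨96 + 2 * (F + 1) + 4 * (F + 1) / δ ^ 2 + 4 * G ^ 2 + L + 48 * L ^ 2 / σ, by positivity,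
    fun βx βy β hx hy hb => ?_⟩
  set C := 96 + 2 * (F + 1) + 4 * (F + 1) / δ ^ 2 + 4 * G ^ 2 + L + 48 * L ^ 2 / σ with hC
  have hC96 : 96 ≤ C := by linarith
  have hβy : 0 < βy := by linarith
  -- This follows from `C * βy ≤ β` because `βy ≥ 96`.
  have hCβ : C ≤ β := by nlinarith
  refine ⟨by linarith, hβy, by linarith, by linarith, ?_, by linarith, by linarith, ?_, ?_⟩
  · rw [← div_le_iff₀ (by positivity)]; linarith
  · rw [mul_comm σ, ← div_le_iff₀ hσ]; linarith
  · nlinarith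

/-- The Lyapunov function: the augmented Lagrangian plus the squared lengths of the last steps in
`y` and `z`. -/
noncomputable def potential (f : Vec n → ℝ≥0∞) (g : Vec m × Vec l → ℝ≥0∞) (A : Vec n →L[ℝ] Vec m)
    (σ βy β : ℝ) (x : Vec n) (y : Vec m) (z : Vec l) (lam : Vec m) (yp : Vec m) (zp : Vec l) : ℝ :=
  realLagrangian f g A β x y z lam + βy / 16 * ‖y - yp‖ ^ 2 + σ / 8 * ‖z - zp‖ ^ 2

/-- The invariant of BC-ADMM, for an iterate `(x, y, z, lam)` whose predecessor has second and third
component `yp` and `zp`. -/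
structure Invariant (f : Vec n → ℝ≥0∞) (g : Vec m × Vec l → ℝ≥0∞) (A : Vec n →L[ℝ] Vec m)
    (Z : Set (Vec l)) (σ F βy β : ℝ) (K : Set (Vec m × Vec l)) (x : Vec n) (y : Vec m) (z : Vec l)
    (lam : Vec m) (yp : Vec m) (zp : Vec l) : Prop where
  z_mem : z ∈ Z
  sublevel : f x + g (A x, z) ≤ ENNReal.ofReal (F + 2)
  g_fin : g (y, z) ≠ ⊤
  mem : (y, z) ∈ K
  mem_prev : (y, zp) ∈ K
  lam_eq : lam = gradY g y zp + βy • (y - yp)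
  potential_le : potential f g A σ βy β x y z lam yp zp ≤ F

section

variable {F G L δ βx βy β : ℝ} {K : Set (Vec m × Vec l)} {x x' : Vec n} {y y' yp : Vec m}
  {z z' zp : Vec l} {lam : Vec m}

lemma Invariant.f_fin (I : Invariant f g A Z σ F βy β K x y z lam yp zp) : f x ≠ ⊤ :=
  (ENNReal.add_ne_top.1 (I.sublevel.trans_lt ENNReal.ofReal_lt_top).ne).1

/-- The multiplier has norm at most `G + βy * ‖y - yp‖`. The loss `‖lam‖ ^ 2 / β` thus splits into a
constant and a term that the `y`-part of `potential` compensates exactly. -/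
lemma Invariant.penalty_ge (B : Bounds f g A σ F G L δ K) (P : Admissible σ F G L δ βx βy β)
    (I : Invariant f g A Z σ F βy β K x y z lam yp zp) (r : Vec m) :
    β / 4 * ‖r‖ ^ 2 - 1 / 2 - βy / 16 * ‖y - yp‖ ^ 2 ≤ penalty β lam r := by
  have hβ := P.β_pos
  have hβy := P.βy_pos
  have h1 : ‖lam‖ ≤ G + βy * ‖y - yp‖ := by
    rw [I.lam_eq]
    refine (norm_add_le _ _).trans (add_le_add (B.gradY_le (y, zp) I.mem_prev) ?_)
    rw [norm_smul, Real.norm_of_nonneg hβy.le]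
  have h2 : ‖lam‖ ^ 2 / β ≤ 1 / 2 + βy / 16 * ‖y - yp‖ ^ 2 := by
    rw [div_le_iff₀ hβ]
    have h3 : ‖lam‖ ^ 2 ≤ (G + βy * ‖y - yp‖) ^ 2 := by gcongr
    have h4 : (G + βy * ‖y - yp‖) ^ 2 ≤ 2 * G ^ 2 + 2 * (βy * ‖y - yp‖) ^ 2 := by
      nlinarith [sq_nonneg (G - βy * ‖y - yp‖)]
    have h5 : 0 ≤ βy * ‖y - yp‖ ^ 2 * (β - 96 * βy) :=
      mul_nonneg (by positivity) (sub_nonneg.2 P.βy_le)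
    have h6 : 0 ≤ (βy * ‖y - yp‖) ^ 2 := by positivity
    nlinarith [P.G_le]
  have := penalty_lower_bound hβ lam r
  linarith

lemma Invariant.neg_le_potential (B : Bounds f g A σ F G L δ K)
    (P : Admissible σ F G L δ βx βy β) (hσ : 0 < σ)
    (I : Invariant f g A Z σ F βy β K x y z lam yp zp) :
    -(1 / 2) ≤ potential f g A σ βy β x y z lam yp zp := by
  have h1 := I.penalty_ge B P (A x - y)
  have h2 : 0 ≤ β / 4 * ‖A x - y‖ ^ 2 := by have := P.β_pos; positivity
  have h3 : 0 ≤ σ / 8 * ‖z - zp‖ ^ 2 := by positivity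
  have h4 := ENNReal.toReal_nonneg (a := f x + g (y, z))
  rw [potential, realLagrangian]
  linarith

/-- Here `a`, `b`, `c`, `r` stand for the current `y`-step, the previous `z`-step, the previous
`y`-step and the residual. Squaring a sum of three terms costs a factor 3, whence the constants 96
and 48 in `Admissible`. The last two coefficients on the right are the weights in `potential`. -/
lemma residual_sq_le (P : Admissible σ F G L δ βx βy β) {a b c r : ℝ} (ha : 0 ≤ a)
    (hr : 0 ≤ r) (h : β * r ≤ L * (a + b) + βy * a + βy * c) :
    2 * β * r ^ 2 ≤ βy / 4 * a ^ 2 + σ / 8 * b ^ 2 + βy / 16 * c ^ 2 := by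
  have hβ := P.β_pos
  have hβy := P.βy_pos
  have h1 : β * r ≤ 2 * βy * a + L * b + βy * c := by
    have := mul_le_mul_of_nonneg_right P.L_le ha
    linarith
  have h2 : (β * r) ^ 2 ≤ (2 * βy * a + L * b + βy * c) ^ 2 := by gcongr
  have h3 : (2 * βy * a + L * b + βy * c) ^ 2
      ≤ 3 * (4 * βy ^ 2 * a ^ 2 + L ^ 2 * b ^ 2 + βy ^ 2 * c ^ 2) := by
    nlinarith [sq_nonneg (2 * βy * a - L * b), sq_nonneg (2 * βy * a - βy * c),
      sq_nonneg (L * b - βy * c)]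
  have h4 : 0 ≤ βy * a ^ 2 * (β - 96 * βy) := mul_nonneg (by positivity) (sub_nonneg.2 P.βy_le)
  have h5 : 0 ≤ βy * c ^ 2 * (β - 96 * βy) := mul_nonneg (by positivity) (sub_nonneg.2 P.βy_le)
  have h6 : 0 ≤ b ^ 2 * (σ * β - 48 * L ^ 2) := mul_nonneg (by positivity) (sub_nonneg.2 P.L_sq_le)
  refine le_of_mul_le_mul_left ?_ hβ
  nlinarith

/-- One iteration preserves the invariant and decreases the potential. -/
lemma Step.invariant (H : Regular f g A Z σ) (B : Bounds f g A σ F G L δ K)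
    (P : Admissible σ F G L δ βx βy β) (I : Invariant f g A Z σ F βy β K x y z lam yp zp)
    (S : Step f g A Z σ βx βy β x y z lam x' y' z') (hz' : z' ∈ Z) :
    Invariant f g A Z σ F βy β K x' y' z' (lam + β • (A x' - y')) y z ∧
      potential f g A σ βy β x' y' z' (lam + β • (A x' - y')) y z + βx / 2 * ‖x' - x‖ ^ 2
        + βy / 8 * ‖y' - y‖ ^ 2 + σ / 8 * ‖z' - z‖ ^ 2 + β * ‖A x' - y'‖ ^ 2
        ≤ potential f g A σ βy β x y z lam yp zp := by
  have hβ := P.β_pos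
  have hβy := P.βy_pos
  have hβx := P.βx_pos
  have hσ := H.pos
  have hδ := B.δ_pos
  have hF := B.F_nonneg
  have d_xy := S.descent_xy
  have d_z := S.descent_z
  have hpen := I.penalty_ge B P (A x' - y')
  have hpot := I.potential_le
  have e1 : f x' + g (y', z) ≠ ⊤ := ENNReal.add_ne_top.2 ⟨S.f_fin, S.g_fin⟩
  have e2 : f x' + g (y', z') ≠ ⊤ := ENNReal.add_ne_top.2 ⟨S.f_fin, S.g_fin'⟩
  have n1 := ENNReal.toReal_nonneg (a := f x' + g (y', z))
  have n2 := ENNReal.toReal_nonneg (a := f x' + g (y', z'))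
  have qx : 0 ≤ βx / 2 * ‖x' - x‖ ^ 2 := by positivity
  have qy : 0 ≤ βy / 16 * ‖y' - y‖ ^ 2 := by positivity
  have qz : 0 ≤ σ / 8 * ‖z' - z‖ ^ 2 := by positivity
  have qzp : 0 ≤ σ / 8 * ‖z - zp‖ ^ 2 := by positivity
  have qr : 0 ≤ β / 4 * ‖A x' - y'‖ ^ 2 := by positivity
  simp only [potential] at hpot
  simp only [realLagrangian] at d_xy d_z hpot
  -- No Lipschitz constant enters here: the term in `‖y - yp‖ ^ 2` lost in `hpen` cancels against
  -- the one in `hpot`, leaving a slack of `1 / 2`.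
  have b1 : f x' + g (y', z) ≤ ENNReal.ofReal (F + 1) := by
    rw [ENNReal.le_ofReal_iff_toReal_le e1 (by linarith)]
    linarith
  have b2 : f x' + g (y', z') ≤ ENNReal.ofReal (F + 1) := by
    rw [ENNReal.le_ofReal_iff_toReal_le e2 (by linarith)]
    linarith
  have hxs : ‖x' - x‖ ≤ 1 := by
    have h1 : βx / 2 * ‖x' - x‖ ^ 2 ≤ βx / 2 * 1 := by linarith [P.x_short]
    have h2 := le_of_mul_le_mul_left h1 (by positivity)
    exact (sq_le_one_iff₀ (norm_nonneg _)).1 h2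
  have hzs : σ * ‖z' - z‖ ^ 2 ≤ 4 * (F + 1) := by linarith
  have hrs : ‖A x' - y'‖ ≤ δ := by
    have h1 : β * ‖A x' - y'‖ ^ 2 ≤ β * δ ^ 2 := by linarith [P.residual_short]
    have h2 := le_of_mul_le_mul_left h1 hβ
    exact (sq_le_sq₀ (norm_nonneg _) hδ.le).1 h2
  -- The intermediate point counts as a step of zero length in `z`.
  have k1 : (y', z) ∈ K :=
    (B.step x z x' y' z I.sublevel hxs (by simpa using by linarith) hrs b1).1
  obtain ⟨k2, hsub⟩ := B.step x z x' y' z' I.sublevel hxs hzs hrs b2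
  -- The factor 2 pays for the increase caused by the multiplier and leaves `β * ‖A x' - y'‖ ^ 2` as
  -- a net decrease.
  have hres : 2 * β * ‖A x' - y'‖ ^ 2
      ≤ βy / 4 * ‖y' - y‖ ^ 2 + σ / 8 * ‖z - zp‖ ^ 2 + βy / 16 * ‖y - yp‖ ^ 2 := by
    refine residual_sq_le P (norm_nonneg _) (norm_nonneg _) ?_
    have h1 : β • (A x' - y')
        = (gradY g y' z - gradY g y zp) + βy • (y' - y) - βy • (y - yp) := by
      have := S.opt_y
      rw [I.lam_eq] at this
      rw [eq_sub_of_add_eq' this]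
      abel
    have h2 : β * ‖A x' - y'‖ = ‖β • (A x' - y')‖ := by
      rw [norm_smul, Real.norm_of_nonneg hβ.le]
    rw [h2, h1]
    refine (norm_sub_le _ _).trans (add_le_add ((norm_add_le _ _).trans (add_le_add ?_ ?_)) ?_)
    · exact B.gradY_lip (y', z) k1 (y, zp) I.mem_prev
    · rw [norm_smul, Real.norm_of_nonneg hβy.le]
    · rw [norm_smul, Real.norm_of_nonneg hβy.le]
  have hlam : penalty β (lam + β • (A x' - y')) (A x' - y')
      = penalty β lam (A x' - y') + β * ‖A x' - y'‖ ^ 2 := by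
    simp only [penalty, inner_add_left, inner_smul_left, real_inner_self_eq_norm_sq, conj_trivial]
    ring
  have hdec : potential f g A σ βy β x' y' z' (lam + β • (A x' - y')) y z + βx / 2 * ‖x' - x‖ ^ 2
        + βy / 8 * ‖y' - y‖ ^ 2 + σ / 8 * ‖z' - z‖ ^ 2 + β * ‖A x' - y'‖ ^ 2
        ≤ potential f g A σ βy β x y z lam yp zp := by
    simp only [potential, realLagrangian, hlam]
    linarith
  refine ⟨⟨hz', hsub, S.g_fin', k2, k1, S.opt_y, ?_⟩, hdec⟩
  have := I.potential_le
  linarith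

/-- The stationarity residual of an iterate is controlled by the length of the last step. -/
lemma Step.isStationary (B : Bounds f g A σ F G L δ K)
    (P : Admissible σ F G L δ βx βy β)
    (I' : Invariant f g A Z σ F βy β K x' y' z' (lam + β • (A x' - y')) y z)
    (S : Step f g A Z σ βx βy β x y z lam x' y' z') {ε : ℝ}
    (hε : (βx + ‖A‖ * (βy + β) + (‖A‖ + 1) * L)
      * (‖x' - x‖ + ‖y' - y‖ + ‖z' - z‖ + ‖A x' - y'‖) ≤ ε) :
    IsStationary f g A Z ε x' z' := by
  have hβ := P.β_pos
  have hβy := P.βy_pos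
  have hβx := P.βx_pos
  have hL := B.L_nonneg
  have hA := norm_nonneg A
  have kA := B.mem x' z' I'.sublevel
  have nx := norm_nonneg (x' - x)
  have ny := norm_nonneg (y' - y)
  have nz := norm_nonneg (z' - z)
  have nr := norm_nonneg (A x' - y')
  refine ⟨I'.z_mem, I'.sublevel.trans_lt ENNReal.ofReal_lt_top, ?_, ?_⟩
  -- The `x`-update uses the old `y` and `lam`; `opt_y` rewrites its multiplier as a gradient of `g`
  -- plus a term proportional to the `y`-step.
  · have h1 : β • (A x' - y) + lam = gradY g y' z + (βy + β) • (y' - y) := by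
      have : β • (A x' - y) + lam = (lam + β • (A x' - y')) + β • (y' - y) := by module
      rw [this, S.opt_y]
      module
    have h2 := S.opt_x
    rw [h1] at h2
    have h3 : grad f x' + ContinuousLinearMap.adjoint A (gradY g (A x') z')
        = ContinuousLinearMap.adjoint A ((gradY g (A x') z' - gradY g y' z)
          - (βy + β) • (y' - y)) - βx • (x' - x) := by
      rw [← sub_eq_zero, ← h2]
      simp only [map_add, map_sub]
      abel
    rw [h3]
    have h4 := B.gradY_lip (A x', z') kA (y', z) I'.mem_prev
    have h5 : ‖(gradY g (A x') z' - gradY g y' z) - (βy + β) • (y' - y)‖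
        ≤ L * (‖A x' - y'‖ + ‖z' - z‖) + (βy + β) * ‖y' - y‖ := by
      refine (norm_sub_le _ _).trans (add_le_add h4 ?_)
      rw [norm_smul, Real.norm_of_nonneg (by positivity)]
    refine (norm_sub_le _ _).trans (le_trans (add_le_add
      (ContinuousLinearMap.le_opNorm_of_le _ h5) (norm_smul_le _ _)) (le_trans ?_ hε))
    rw [LinearIsometryEquiv.norm_map, Real.norm_of_nonneg hβx.le]
    have t1 : 0 ≤ βx * (‖y' - y‖ + ‖z' - z‖ + ‖A x' - y'‖) := by positivity
    have t2 : 0 ≤ ‖A‖ * (βy + β) * (‖x' - x‖ + ‖z' - z‖ + ‖A x' - y'‖) := by positivity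
    have t3 : 0 ≤ ‖A‖ * L * (‖x' - x‖ + ‖y' - y‖) := by positivity
    have t4 : 0 ≤ L * (‖x' - x‖ + ‖y' - y‖ + ‖z' - z‖ + ‖A x' - y'‖) := by positivity
    linarith
  · refine (Metric.infDist_le_dist_of_mem S.opt_z).trans (le_trans ?_ hε)
    rw [dist_eq_norm, neg_sub_neg, norm_sub_rev]
    refine (B.gradZ_lip (A x', z') kA (y', z') I'.mem).trans ?_
    simp only [sub_self, norm_zero, add_zero]
    have t1 : 0 ≤ (βx + ‖A‖ * (βy + β) + ‖A‖ * L)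
      * (‖x' - x‖ + ‖y' - y‖ + ‖z' - z‖ + ‖A x' - y'‖) := by positivity
    have t2 : 0 ≤ L * (‖x' - x‖ + ‖y' - y‖ + ‖z' - z‖) := by positivity
    linarith

end

/-! ### Runs -/

section

variable {F G L δ βx βy β : ℝ} {K : Set (Vec m × Vec l)} {x₀ : Vec n} {x : ℕ → Vec n}
  {y : ℕ → Vec m} {z : ℕ → Vec l} {lam : ℕ → Vec m}

lemma IsRun.sublevel_zero (R : IsRun f g A Z βx βy β x₀ x y z lam) {w : Vec l}
    (hw : w ∈ Z) (hFw : f x₀ + g (A x₀, w) = ENNReal.ofReal F) :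
    f (x 0) + g (y 0, z 0) ≤ ENNReal.ofReal F := by
  have h := R.z_zero_min hw
  simp only [mem_ofPred_eq] at h
  rw [← hFw, R.x_zero]
  rw [R.y_zero] at h ⊢
  gcongr

/-- Since `0 - 1 = 0` in `ℕ`, the start counts as its own predecessor. The previous steps vanish,
and the choice of `lam 0` is the required multiplier identity. -/
lemma IsRun.invariant_zero (B : Bounds f g A σ F G L δ K)
    (R : IsRun f g A Z βx βy β x₀ x y z lam)
    (h0 : f (x 0) + g (y 0, z 0) ≤ ENNReal.ofReal F) :
    Invariant f g A Z σ F βy β K (x 0) (y 0) (z 0) (lam 0) (y (0 - 1)) (z (0 - 1)) := by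
  have hA : A (x 0) = y 0 := by rw [R.x_zero, R.y_zero]
  have hsub : f (x 0) + g (A (x 0), z 0) ≤ ENNReal.ofReal (F + 2) := by
    rw [hA]
    exact h0.trans (ENNReal.ofReal_le_ofReal (by linarith))
  have hfin : f (x 0) + g (y 0, z 0) ≠ ⊤ := (h0.trans_lt ENNReal.ofReal_lt_top).ne
  have hmem : (y 0, z 0) ∈ K := hA ▸ B.mem _ _ hsub
  refine ⟨R.z_zero_mem, hsub, (ENNReal.add_ne_top.1 hfin).2, hmem, hmem, ?_, ?_⟩
  · simp [R.lam_zero]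
  · have := (ENNReal.le_ofReal_iff_toReal_le hfin B.F_nonneg).1 h0
    simpa [potential, realLagrangian, hA, penalty] using this

lemma IsRun.invariant (H : Regular f g A Z σ) (B : Bounds f g A σ F G L δ K)
    (P : Admissible σ F G L δ βx βy β) (R : IsRun f g A Z βx βy β x₀ x y z lam)
    (h0 : f (x 0) + g (y 0, z 0) ≤ ENNReal.ofReal F) (k : ℕ) :
    Invariant f g A Z σ F βy β K (x k) (y k) (z k) (lam k) (y (k - 1)) (z (k - 1)) := by
  induction k with
  | zero => exact R.invariant_zero B h0
  | succ k ih =>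
    have := (Step.invariant H B P ih (R.step H ih.z_mem ih.f_fin ih.g_fin) (R.z_mem k)).1
    rwa [← R.lam_succ] at this

lemma IsRun.isStationary_zero (H : Regular f g A Z σ) (B : Bounds f g A σ F G L δ K)
    (R : IsRun f g A Z βx βy β x₀ x y z lam)
    (h0 : f (x 0) + g (y 0, z 0) ≤ ENNReal.ofReal F) {ε : ℝ} (hε : ‖grad f x₀‖ + ‖A‖ * G ≤ ε) :
    IsStationary f g A Z ε (x 0) (z 0) := by
  have I := R.invariant_zero B h0
  have hA : A (x 0) = y 0 := by rw [R.x_zero, R.y_zero]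
  have hε0 : 0 ≤ ε := le_trans (add_nonneg (norm_nonneg _)
    (mul_nonneg (norm_nonneg _) B.G_nonneg)) hε
  refine ⟨I.z_mem, I.sublevel.trans_lt ENNReal.ofReal_lt_top, ?_, ?_⟩
  · refine (norm_add_le _ _).trans (le_trans (add_le_add (le_of_eq (by rw [R.x_zero])) ?_) hε)
    refine (ContinuousLinearMap.le_opNorm_of_le _ (B.gradY_le _ (B.mem _ _ I.sublevel))).trans ?_
    rw [LinearIsometryEquiv.norm_map]
  · rw [hA, Metric.infDist_zero_of_mem (R.neg_gradZ_zero_mem H I.g_fin)]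
    exact hε0

/-- The residuals are square summable along a run, with a bound that is independent of the run. -/
lemma exists_residual_constant (H : Regular f g A Z σ) (B : Bounds f g A σ F G L δ K)
    (P : Admissible σ F G L δ βx βy β) :
    ∃ T : ℝ, 0 ≤ T ∧ ∀ x₀ x y z lam, IsRun f g A Z βx βy β x₀ x y z lam →
      f (x 0) + g (y 0, z 0) ≤ ENNReal.ofReal F → ∀ (k : ℕ) (ε : ℝ), 0 < ε →
      ¬ IsStationary f g A Z ε (x (k + 1)) (z (k + 1)) →
      ε ^ 2 + T * potential f g A σ βy β (x (k + 1)) (y (k + 1)) (z (k + 1)) (lam (k + 1)) (y k) (z k)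
        ≤ T * potential f g A σ βy β (x k) (y k) (z k) (lam k) (y (k - 1)) (z (k - 1)) := by
  have hβ := P.β_pos
  have hβy := P.βy_pos
  have hβx := P.βx_pos
  have hσ := H.pos
  let M := βx + ‖A‖ * (βy + β) + (‖A‖ + 1) * L
  -- `κ` is the smallest weight among the four squared terms in the decrease of the potential.
  let κ := min (min (βx / 2) (βy / 8)) (min (σ / 8) β)
  have hκ : 0 < κ := by positivity
  refine ⟨4 * M ^ 2 / κ, by positivity, fun x₀ x y z lam R h0 k ε hε hns => ?_⟩
  have I := R.invariant H B P h0 k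
  have S := R.step H I.z_mem I.f_fin I.g_fin
  obtain ⟨I', hdec⟩ := Step.invariant H B P I S (R.z_mem k)
  have hlt : ε < M * (‖x (k + 1) - x k‖ + ‖y (k + 1) - y k‖ + ‖z (k + 1) - z k‖
      + ‖A (x (k + 1)) - y (k + 1)‖) := by
    by_contra! hle
    exact hns (Step.isStationary B P I' S hle)
  rw [← R.lam_succ] at hdec
  set a := ‖x (k + 1) - x k‖
  set b := ‖y (k + 1) - y k‖
  set c := ‖z (k + 1) - z k‖
  set d := ‖A (x (k + 1)) - y (k + 1)‖
  have h1 : ε ^ 2 ≤ M ^ 2 * (a + b + c + d) ^ 2 := by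
    rw [← mul_pow]
    gcongr
  have h2 : (a + b + c + d) ^ 2 ≤ 4 * (a ^ 2 + b ^ 2 + c ^ 2 + d ^ 2) := by
    nlinarith [sq_nonneg (a - b), sq_nonneg (a - c), sq_nonneg (a - d), sq_nonneg (b - c),
      sq_nonneg (b - d), sq_nonneg (c - d)]
  have h3 : κ * (a ^ 2 + b ^ 2 + c ^ 2 + d ^ 2)
      ≤ βx / 2 * a ^ 2 + βy / 8 * b ^ 2 + σ / 8 * c ^ 2 + β * d ^ 2 := by
    have k1 : κ ≤ βx / 2 := (min_le_left _ _).trans (min_le_left _ _)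
    have k2 : κ ≤ βy / 8 := (min_le_left _ _).trans (min_le_right _ _)
    have k3 : κ ≤ σ / 8 := (min_le_right _ _).trans (min_le_left _ _)
    have k4 : κ ≤ β := (min_le_right _ _).trans (min_le_right _ _)
    rw [mul_add, mul_add, mul_add]
    gcongr
  have h4 : M ^ 2 * (a + b + c + d) ^ 2
      ≤ 4 * M ^ 2 / κ * (κ * (a ^ 2 + b ^ 2 + c ^ 2 + d ^ 2)) := by
    have : 4 * M ^ 2 / κ * (κ * (a ^ 2 + b ^ 2 + c ^ 2 + d ^ 2))
        = M ^ 2 * (4 * (a ^ 2 + b ^ 2 + c ^ 2 + d ^ 2)) := by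
      field_simp
    rw [this]
    gcongr
  have h5 := mul_le_mul_of_nonneg_left (h3.trans (by linarith : _ ≤
    potential f g A σ βy β (x k) (y k) (z k) (lam k) (y (k - 1)) (z (k - 1)) -
    potential f g A σ βy β (x (k + 1)) (y (k + 1)) (z (k + 1)) (lam (k + 1)) (y k) (z k)))
    (by positivity : 0 ≤ 4 * M ^ 2 / κ)
  rw [mul_sub] at h5
  linarith

theorem exists_complexity_constant (H : Regular f g A Z σ) (B : Bounds f g A σ F G L δ K)
    (P : Admissible σ F G L δ βx βy β) (x₀ : Vec n) :
    ∃ D : ℝ, ∀ ε : ℝ, 0 < ε → ∀ x y z lam, IsRun f g A Z βx βy β x₀ x y z lam →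
      f (x 0) + g (y 0, z 0) ≤ ENNReal.ofReal F →
      ∃ k : ℕ, (k : ℝ) ≤ D / ε ^ 2 ∧ IsStationary f g A Z ε (x k) (z k) := by
  obtain ⟨T, hT, hTres⟩ := exists_residual_constant H B P
  have hF := B.F_nonneg
  -- The second term comes from telescoping over the iterates with index at least 1. The first
  -- treats index 0, which no step precedes and which is the only one allowed when `ε` is large.
  let D := (‖grad f x₀‖ + ‖A‖ * G) ^ 2 + T * (F + 1)
  have hD : 0 ≤ D := by positivity
  refine ⟨D, fun ε hε x y z lam R h0 => ?_⟩
  by_contra! hns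
  have hns' : ∀ k ≤ ⌊D / ε ^ 2⌋₊, ¬ IsStationary f g A Z ε (x k) (z k) := fun k hk =>
    hns k ((Nat.le_floor_iff (by positivity)).1 hk)
  have hind : ∀ k ≤ ⌊D / ε ^ 2⌋₊, k * ε ^ 2
      + T * potential f g A σ βy β (x k) (y k) (z k) (lam k) (y (k - 1)) (z (k - 1)) ≤ T * F := by
    intro k
    induction k with
    | zero =>
      intro _
      simpa using mul_le_mul_of_nonneg_left (R.invariant_zero B h0).potential_le hT
    | succ k ih =>
      intro hk
      have h1 := ih (by omega)
      have h2 := hTres x₀ x y z lam R h0 k ε hε (hns' _ hk)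
      simp only [Nat.add_sub_cancel] at *
      push_cast
      linarith
  have hend := hind _ le_rfl
  have hlow := mul_le_mul_of_nonneg_left
    ((R.invariant H B P h0 ⌊D / ε ^ 2⌋₊).neg_le_potential B P H.pos) hT
  have hε0 : ε ^ 2 ≤ (‖grad f x₀‖ + ‖A‖ * G) ^ 2 := by
    have : ε ≤ ‖grad f x₀‖ + ‖A‖ * G := by
      by_contra! hlt
      exact hns' 0 (Nat.zero_le _) (R.isStationary_zero H B h0 hlt.le)
    gcongr
  have hfloor := Nat.lt_floor_add_one (D / ε ^ 2)
  rw [div_lt_iff₀ (by positivity)] at hfloor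
  have : D = (‖grad f x₀‖ + ‖A‖ * G) ^ 2 + T * (F + 1) := rfl
  linarith

end

end BCADMM

theorem theorem1 {n m l : ℕ}
    (f : BCADMM.Vec n → ℝ≥0∞) (g : BCADMM.Vec m × BCADMM.Vec l → ℝ≥0∞)
    (A : BCADMM.Vec n →L[ℝ] BCADMM.Vec m) (Z : Set (BCADMM.Vec l)) (σ : ℝ) (hσ : 0 < σ)
    -- `f` is continuous, and differentiable on its domain
    (hf_cont : Continuous f)
    (hf_diff : ∀ x ∈ BCADMM.dom f, DifferentiableAt ℝ (fun u => (f u).toReal) x)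
    -- `g` is continuous, and twice continuously differentiable on its domain
    (hg_cont : Continuous g)
    (hg_diff : ContDiffOn ℝ 2 (fun p => (g p).toReal) (BCADMM.dom g))
    -- `(x, z) ↦ f x + g (A x, z)` is coercive
    (hcoer : BCADMM.Coercive
      (fun p : BCADMM.Vec n × BCADMM.Vec l => f p.1 + g (A p.1, p.2)))
    -- `g` is convex in its first and `σ`-strongly convex in its second argument
    (hg_convex : ∀ z, ConvexOn ℝ (BCADMM.dom fun y => g (y, z)) (fun y => (g (y, z)).toReal))
    (hg_strong : ∀ y,
      StrongConvexOn (BCADMM.dom fun z => g (y, z)) σ (fun z => (g (y, z)).toReal))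
    (hZ : Convex ℝ Z)
    -- a strictly feasible start
    (x₀ : BCADMM.Vec n) (hx₀ : ∃ z ∈ Z, f x₀ + g (A x₀, z) < ⊤) :
    ∃ C : ℝ, 0 < C ∧ ∀ βx βy β : ℝ, C ≤ βx → C ≤ βy → C * βy ≤ β →
      -- the iteration can be carried out
      (IsClosed Z → ∃ x y z lam, BCADMM.IsRun f g A Z βx βy β x₀ x y z lam) ∧
      -- every iterate is strictly feasible
      (∀ x y z lam, BCADMM.IsRun f g A Z βx βy β x₀ x y z lam →
        ∀ k, f (x k) + g (A (x k), z k) < ⊤) ∧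
      -- an `ε`-stationary point is reached within `O(ε⁻²)` iterations
      (∃ D : ℝ, ∀ ε : ℝ, 0 < ε →
        ∀ x y z lam, BCADMM.IsRun f g A Z βx βy β x₀ x y z lam →
          ∃ k : ℕ, (k : ℝ) ≤ D / ε ^ 2 ∧ BCADMM.IsStationary f g A Z ε (x k) (z k)) := by
  have H : BCADMM.Regular f g A Z σ :=
    ⟨hσ, hf_cont, hf_diff, hg_cont, hg_diff, hcoer, hg_strong, hZ⟩
  obtain ⟨w, hw, hfin⟩ := hx₀
  have hFw : f x₀ + g (A x₀, w) = ENNReal.ofReal (f x₀ + g (A x₀, w)).toReal :=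
    (ENNReal.ofReal_toReal hfin.ne).symm
  -- Here `F` is the objective at the given feasible `w`; it dominates the starting value because `z
  -- 0` is a minimizer. All constants are fixed before `βx`, `βy` and `β`, so `C` does not depend on
  -- them.
  obtain ⟨G, L, δ, K, B⟩ := H.exists_bounds (ENNReal.toReal_nonneg (a := f x₀ + g (A x₀, w)))
  obtain ⟨C, hC, hadm⟩ := BCADMM.exists_admissible (G := G) hσ B.F_nonneg B.L_nonneg B.δ_pos
  refine ⟨C, hC, fun βx βy β hβx hβy hβ => ?_⟩
  have P := hadm βx βy β hβx hβy hβ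
  refine ⟨fun hclosed => BCADMM.exists_isRun H hclosed ⟨w, hw⟩ P.βx_pos P.βy_pos P.β_pos x₀, ?_, ?_⟩
  · intro x y z lam R k
    exact (R.invariant H B P (R.sublevel_zero hw hFw) k).sublevel.trans_lt
      ENNReal.ofReal_lt_top
  · obtain ⟨D, hD⟩ := BCADMM.exists_complexity_constant H B P x₀
    exact ⟨D, fun ε hε x y z lam R =>
      hD ε hε x y z lam R (R.sublevel_zero hw hFw)⟩
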